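/- Let $\Gamma$ be a countable (discrete, additive) abelian group with compact dual group $\widehat\Gamma$, and let $\alpha$ be an injective endomorphism of $\Gamma$ such that $\alpha(\Gamma)$ has finite index $N$ in $\Gamma$ and $\bigcap_{n\ge 0}\alpha^n(\Gamma)=\{0\}$. Let $\alpha^*$ be the dual endomorphism $\omega\mapsto\omega\circ\alpha$ of $\widehat\Gamma$, and use normalized Haar measure on $\widehat\Gamma$. Suppose that $B\subset\widehat\Gamma$ is a Borel set and that $m:\widehat\Gamma\to\mathbb C$ is a Borel function which vanishes almost everywhere on $\widehat\Gamma\setminus B$ and satisfies $$\sum_{\alpha^*(\zeta)=\omega}|m(\zeta)|^2=N\chi_B(\omega)\quad\text{for almost all }\omega\in\widehat\Gamma .$$ Regard $L^2(B)$ as the space of those functions in $L^2(\widehat\Gamma)$ that vanish almost everywhere off $B$. If either (a) $\widehat\Gamma\setminus B$ has positive Haar measure, or (b) $|m(\omega)|\neq 1$ on a set of positive Haar measure, then the formula $(S_mf)(\omega)=m(\omega)f(\alpha^*(\omega))$ defines a pure isometry $S_m:L^2(B)\to L^2(B)$, that is, $S_m$ is a well-defined linear isometry of $L^2(B)$ into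 itself and $\bigcap_{n\ge 0}S_m^nL^2(B)=\{0\}$, so that the Wold decomposition of $S_m$ has no unitary part. -/

import Mathlib

open MeasureTheory

noncomputable section

/-- The dual group of the discrete abelian group `Γ` (written additively): the group of all
homomorphisms `Γ → 𝕋`, with the compact-open topology. -/
abbrev DualGroup (Γ : Type*) [AddCommGroup Γ] [TopologicalSpace Γ] : Type _ :=
  PontryaginDual (Multiplicative Γ)

section DualGroup

variable {Γ : Type*} [AddCommGroup Γ] [TopologicalSpace Γ]

/-- The Borel `σ`-algebra of the dual group. -/
instance dualMeasurableSpace : MeasurableSpace (DualGroup Γ) := borel _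

instance dualBorelSpace : BorelSpace (DualGroup Γ) := ⟨rfl⟩

variable [DiscreteTopology Γ]

variable (Γ) in
/-- Normalized Haar measure on the compact dual group (total mass one). -/
def dualHaar : Measure (DualGroup Γ) :=
  Measure.haarMeasure (⊤ : TopologicalSpace.PositiveCompacts (DualGroup Γ))

instance dualHaar_isHaarMeasure : (dualHaar Γ).IsHaarMeasure :=
  Measure.isHaarMeasure_haarMeasure _

instance dualHaar_isProbabilityMeasure : IsProbabilityMeasure (dualHaar Γ) :=
  ⟨Measure.haarMeasure_self⟩

/-- The dual endomorphism `α* : ω ↦ ω ∘ α` of the dual group. -/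
def dualEndo (α : Γ →+ Γ) : DualGroup Γ →ₜ* DualGroup Γ :=
  PontryaginDual.map
    { AddMonoidHom.toMultiplicative α with
      continuous_toFun := continuous_of_discreteTopology }

theorem dualEndo_apply (α : Γ →+ Γ) (ω : DualGroup Γ) (γ : Γ) :
    dualEndo α ω (Multiplicative.ofAdd γ) = ω (Multiplicative.ofAdd (α γ)) :=
  rfl

/-- The Hilbert space `L²(B)` for a subset `B` of the dual group, with respect to Haar measure. -/
abbrev L2On (B : Set (DualGroup Γ)) : Type _ :=
  Lp ℂ 2 ((dualHaar Γ).restrict B)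

end DualGroup

section Wold

variable {H : Type*} [NormedAddCommGroup H] [InnerProductSpace ℂ H]

/-- The space `⋂ₙ Sⁿ H` of the unitary summand in the Wold decomposition of an isometry `S`. -/
def woldUnitaryPart (S : H →L[ℂ] H) : Submodule ℂ H :=
  ⨅ n : ℕ, LinearMap.range ((S ^ n : H →L[ℂ] H) : H →ₗ[ℂ] H)

/-- A pure isometry: an isometry whose Wold decomposition has no unitary summand. -/
def IsPureIsometry (S : H →L[ℂ] H) : Prop :=
  (∀ x, ‖S x‖ = ‖x‖) ∧ woldUnitaryPart S = ⊥

end Wold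

end

/-! A vector in every range `S ^ n` has unique backward iterates, giving functions with `F n = m · F
(n+1) ∘ α*`. Integrated against Haar measure over the fibres of `α*`, the filter equation reads `∫
|m|² (G ∘ α*) = ∫_B G` (`IsIntegratedFilter`). It makes `S` isometric, and it makes `|F n|²` the
density of the push-forward of `|F 0|²` under the `n`-th iterate of `α*`.

The endomorphism `α*` is exact: since the ranges of the `αⁿ` shrink to zero, each nontrivial
character is eventually nontrivial on the kernel of `α*ⁿ`, hence orthogonal to every `g ∘ α*ⁿ`. So
`∫ h (g ∘ α*ⁿ)` tends to `∫ h · ∫ g`, uniformly over `|g| ≤ 1`, and `|F n|²` tends in L¹ to the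
constant `c = ‖F 0‖²`. Passing to the limit in `|F n|² = |m|² |F (n+1)|² ∘ α*` gives `c = c |m|²`
almost everywhere, so `c = 0` once `|m| ≠ 1` on a set of positive measure. Case (a) reduces to this,
as `m` vanishes off `B`. -/

/-! ### Iterates of an injective endomorphism -/

section Iterate

variable {Γ : Type*} [AddCommGroup Γ]

/-- The iterates of an endomorphism, as additive homomorphisms. -/
def AddMonoidHom.iterate (α : Γ →+ Γ) : ℕ → (Γ →+ Γ)
  | 0 => AddMonoidHom.id Γ
  | n + 1 => α.comp (AddMonoidHom.iterate α n)

theorem AddMonoidHom.iterate_apply (α : Γ →+ Γ) (n : ℕ) (γ : Γ) :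
    α.iterate n γ = α^[n] γ := by
  induction n with
  | zero => rfl
  | succ n ih => rw [Function.iterate_succ_apply', ← ih]; rfl

theorem finiteIndex_range_iterate {α : Γ →+ Γ} (hα : Function.Injective α)
    (h : α.range.FiniteIndex) (n : ℕ) : (α.iterate n).range.FiniteIndex := by
  induction n with
  | zero =>
    have : (α.iterate 0).range = ⊤ := AddMonoidHom.range_eq_top.2 Function.surjective_id
    rw [this]; infer_instance
  | succ n ih =>
    have : (α.iterate (n + 1)).range = (α.iterate n).range.map α :=
      (AddMonoidHom.map_range α (α.iterate n)).symm
    rw [this]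
    exact ⟨by rw [AddSubgroup.index_map_of_injective _ hα]
              exact mul_ne_zero ih.index_ne_zero h.index_ne_zero⟩

end Iterate

/-! ### Duality: characters, and the kernel and image of `α*` -/

noncomputable section Characters

variable {Γ : Type*} [AddCommGroup Γ] [TopologicalSpace Γ] [DiscreteTopology Γ]

/-- A homomorphism from the discrete group `Γ` to the circle, as a point of the dual group. -/
def DualGroup.ofHom (φ : Γ →+ Additive Circle) : DualGroup Γ :=
  ({ AddMonoidHom.toMultiplicativeLeft φ with
      continuous_toFun := continuous_of_discreteTopology } : Multiplicative Γ →ₜ* Circle)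

theorem DualGroup.ofHom_apply (φ : Γ →+ Additive Circle) (γ : Γ) :
    DualGroup.ofHom φ (Multiplicative.ofAdd γ) = (φ γ).toMul := rfl

theorem Circle.exists_zpow_eq {n : ℤ} (hn : n ≠ 0) (z : Circle) : ∃ w : Circle, w ^ n = z := by
  refine ⟨Circle.exp (Complex.arg z / n), ?_⟩
  have hn' : (n : ℝ) ≠ 0 := by exact_mod_cast hn
  rw [← Circle.exp_intCast_mul]
  rw [mul_div_cancel₀ _ hn', Circle.exp_arg]

theorem Circle.baer_additive : Module.Baer ℤ (Additive Circle) := by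
  have : DivisibleBy (Additive Circle) ℤ := divisibleByOfSMulRightSurj _ _ fun {n} hn z =>
    (Circle.exists_zpow_eq hn z.toMul).imp fun w hw => hw
  exact Module.Baer.of_divisible _

/-- The circle is divisible, hence injective, so characters extend along the embedding `α`. -/
theorem dualEndo_surjective {α : Γ →+ Γ} (hα : Function.Injective α) :
    Function.Surjective (dualEndo α) := by
  intro ω
  obtain ⟨φ, hφ⟩ := Circle.baer_additive.extension_property_addMonoidHom α hα
    (MonoidHom.toAdditiveRight (ω : Multiplicative Γ →* Circle))
  refine ⟨DualGroup.ofHom φ, PontryaginDual.ext fun γ => ?_⟩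
  exact DFunLike.congr_fun hφ γ.toAdd

theorem measurePreserving_dualEndo {α : Γ →+ Γ} (hα : Function.Injective α) :
    MeasurePreserving (dualEndo α) (dualHaar Γ) (dualHaar Γ) :=
  (dualEndo α : DualGroup Γ →* DualGroup Γ).measurePreserving (map_continuous (dualEndo α))
    (dualEndo_surjective hα) (by simp)

/-- Characters of a quotient are the points of the dual group that annihilate the subgroup. -/
def annihilatorEquiv (H : AddSubgroup Γ) :
    AddChar (Γ ⧸ H) Circle ≃ {ω : DualGroup Γ // ∀ γ ∈ H, ω (Multiplicative.ofAdd γ) = 1} where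
  toFun ψ := ⟨DualGroup.ofHom (ψ.toAddMonoidHom.comp (QuotientAddGroup.mk' H)), fun γ hγ => by
    have : (γ : Γ ⧸ H) = 0 := (QuotientAddGroup.eq_zero_iff γ).2 hγ
    simp [DualGroup.ofHom_apply, this]⟩
  invFun ω := AddChar.toAddMonoidHomEquiv.symm <| QuotientAddGroup.lift H
    (MonoidHom.toAdditiveRight (ω.1 : Multiplicative Γ →* Circle)) ω.2
  left_inv ψ := by
    ext x
    induction x using QuotientAddGroup.induction_on
    rfl
  right_inv ω := by
    ext x
    rfl

theorem dualEndo_eq_one_iff {α : Γ →+ Γ} {ω : DualGroup Γ} :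
    dualEndo α ω = 1 ↔ ∀ γ ∈ α.range, ω (Multiplicative.ofAdd γ) = 1 := by
  constructor
  · rintro h _ ⟨γ, rfl⟩
    rw [← dualEndo_apply, h]
    rfl
  · intro h
    exact PontryaginDual.ext fun γ => h _ ⟨γ.toAdd, rfl⟩

theorem finite_ker_dualEndo {α : Γ →+ Γ} (h : α.range.FiniteIndex) :
    Finite (dualEndo α : DualGroup Γ →* DualGroup Γ).ker := by
  have : Finite (AddChar (Γ ⧸ α.range) Circle) :=
    Finite.of_equiv _ AddChar.circleEquivComplex.toEquiv.symm
  exact Finite.of_equiv _ ((annihilatorEquiv α.range).trans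
    (Equiv.subtypeEquivRight fun ω => dualEndo_eq_one_iff.symm))

/-- The kernel is the dual of the finite group `Γ ⧸ α.range`, which has as many characters as
elements. -/
theorem card_ker_dualEndo {α : Γ →+ Γ} (h : α.range.FiniteIndex) :
    Nat.card (dualEndo α : DualGroup Γ →* DualGroup Γ).ker = α.range.index := by
  have e := (annihilatorEquiv α.range).trans
    (Equiv.subtypeEquivRight fun ω => (dualEndo_eq_one_iff (ω := ω)).symm)
  have := Fintype.ofFinite (Γ ⧸ α.range)
  have h1 := AddChar.card_eq (α := Γ ⧸ α.range)
  rw [← Nat.card_eq_fintype_card, ← Nat.card_eq_fintype_card,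
    ← Nat.card_congr AddChar.circleEquivComplex.toEquiv] at h1
  rw [AddSubgroup.index, ← h1]
  exact (Nat.card_congr e).symm

theorem exists_annihilator_apply_ne_one (H : AddSubgroup Γ) [H.FiniteIndex] {γ : Γ} (hγ : γ ∉ H) :
    ∃ ω : DualGroup Γ, (∀ x ∈ H, ω (Multiplicative.ofAdd x) = 1) ∧
      ω (Multiplicative.ofAdd γ) ≠ 1 := by
  have h0 : (γ : Γ ⧸ H) ≠ 0 := fun h => hγ ((QuotientAddGroup.eq_zero_iff γ).1 h)
  obtain ⟨ψ, hψ⟩ := AddChar.exists_apply_ne_zero.2 h0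
  refine ⟨_, (annihilatorEquiv H (AddChar.circleEquivComplex.symm ψ)).2, fun h => hψ ?_⟩
  have h1 : (AddChar.circleEquivComplex.symm ψ) (γ : Γ ⧸ H) = 1 := h
  obtain ⟨χ, rfl⟩ := AddChar.circleEquivComplex.surjective ψ
  rw [AddEquiv.symm_apply_apply] at h1
  exact congrArg (fun z : Circle => (z : ℂ)) h1

theorem iterate_dualEndo_apply (α : Γ →+ Γ) (n : ℕ) (ω : DualGroup Γ) (γ : Γ) :
    (dualEndo α)^[n] ω (Multiplicative.ofAdd γ) = ω (Multiplicative.ofAdd (α^[n] γ)) := by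
  induction n generalizing ω with
  | zero => rfl
  | succ n ih => rw [Function.iterate_succ_apply, ih, dualEndo_apply, Function.iterate_succ_apply']

/-- For `n` large, the kernel of the `n`-th iterate of the dual endomorphism is not annihilated by
a given nonzero `γ`. -/
theorem exists_iterate_eq_one_apply_ne_one {α : Γ →+ Γ} (hα : Function.Injective α)
    (hindex : α.range.FiniteIndex) (hinter : ⋂ n : ℕ, Set.range (α^[n]) = {0})
    {γ : Γ} (hγ : γ ≠ 0) :
    ∃ n₀ : ℕ, ∀ n ≥ n₀, ∃ ω : DualGroup Γ, (dualEndo α)^[n] ω = 1 ∧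
      ω (Multiplicative.ofAdd γ) ≠ 1 := by
  have h1 : γ ∉ ⋂ n : ℕ, Set.range (α^[n]) := by rwa [hinter]
  obtain ⟨n₀, h2⟩ : ∃ n₀, γ ∉ Set.range (α^[n₀]) := by simpa using h1
  refine ⟨n₀, fun n hn => ?_⟩
  -- The ranges decrease, so a point missed at stage `n₀` is missed from then on.
  have h3 : γ ∉ (α.iterate n).range := by
    rintro ⟨x, hx⟩
    refine h2 ⟨α^[n - n₀] x, ?_⟩
    rw [← Function.iterate_add_apply, Nat.add_sub_cancel' hn, ← hx, AddMonoidHom.iterate_apply]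
  have := finiteIndex_range_iterate hα hindex n
  obtain ⟨ω, hω, hne⟩ := exists_annihilator_apply_ne_one _ h3
  refine ⟨ω, PontryaginDual.ext fun x => ?_, hne⟩
  rw [← ofAdd_toAdd x, iterate_dualEndo_apply]
  exact hω _ ⟨x.toAdd, α.iterate_apply n _⟩

end Characters

/-! ### Exactness of `α*` -/

noncomputable section Mixing

variable {Γ : Type*} [AddCommGroup Γ] [TopologicalSpace Γ]

/-- Evaluation at `γ`, as a continuous function on the dual group. -/
def evalChar (γ : Γ) : C(DualGroup Γ, ℂ) where
  toFun ω := (ω (Multiplicative.ofAdd γ) : ℂ)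
  continuous_toFun := continuous_subtype_val.comp <|
    (continuous_eval_const (F := Multiplicative Γ →ₜ* Circle) (Multiplicative.ofAdd γ))

theorem evalChar_apply (γ : Γ) (ω : DualGroup Γ) :
    evalChar γ ω = (ω (Multiplicative.ofAdd γ) : ℂ) := rfl

theorem evalChar_mul_apply (γ : Γ) (ω k : DualGroup Γ) :
    evalChar γ (k * ω) = evalChar γ k * evalChar γ ω := by
  simp only [evalChar_apply, ← Circle.coe_mul]
  rfl

variable [DiscreteTopology Γ]

/-- Stone–Weierstrass: characters are closed under products and conjugation, so their span is
already a star subalgebra. -/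
theorem dense_span_evalChar :
    (Submodule.span ℂ (Set.range (evalChar (Γ := Γ)))).topologicalClosure = ⊤ := by
  let A : StarSubalgebra ℂ C(DualGroup Γ, ℂ) :=
    { toSubalgebra := Algebra.adjoin ℂ (Set.range (evalChar (Γ := Γ)))
      star_mem' := by
        change Algebra.adjoin ℂ (Set.range (evalChar (Γ := Γ))) ≤
          star (Algebra.adjoin ℂ (Set.range (evalChar (Γ := Γ))))
        refine Algebra.adjoin_le ?_
        rintro _ ⟨γ, rfl⟩
        refine Algebra.subset_adjoin ⟨-γ, ?_⟩
        ext ω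
        simp [evalChar_apply, ← Circle.coe_inv_eq_conj] }
  have hspan : A.toSubalgebra.toSubmodule = Submodule.span ℂ (Set.range (evalChar (Γ := Γ))) := by
    refine Algebra.adjoin_eq_span_of_subset (R := ℂ) (s := Set.range (evalChar (Γ := Γ))) ?_
    refine Set.Subset.trans ?_ Submodule.subset_span
    intro f hf
    refine Submonoid.closure_induction (fun _ => id) ⟨0, ?_⟩ ?_ hf
    · ext ω
      simp [evalChar_apply]
    · rintro _ _ _ _ ⟨a, rfl⟩ ⟨b, rfl⟩
      refine ⟨a + b, ?_⟩
      ext ω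
      simp [evalChar_apply]
  have hA : A.SeparatesPoints := by
    intro ω₁ ω₂ hne
    obtain ⟨γ, hγ⟩ : ∃ γ, ω₁ γ ≠ ω₂ γ := by
      by_contra! h
      exact hne (PontryaginDual.ext h)
    exact ⟨_, ⟨evalChar γ.toAdd, Algebra.subset_adjoin ⟨_, rfl⟩, rfl⟩,
      fun h => hγ (Subtype.ext h)⟩
  rw [← hspan]
  exact congrArg (Subalgebra.toSubmodule <| StarSubalgebra.toSubalgebra ·)
    (ContinuousMap.starSubalgebra_topologicalClosure_eq_top_of_separatesPoints A hA)

variable {α : Γ →+ Γ}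

theorem iterate_dualEndo_mul (n : ℕ) (k ω : DualGroup Γ) :
    (dualEndo α)^[n] (k * ω) = (dualEndo α)^[n] k * (dualEndo α)^[n] ω :=
  iterate_map_mul (dualEndo α) n k ω

/-- Translation by `k` preserves the integral and fixes `g ∘ α*ⁿ`, but multiplies the character by a
constant other than 1. -/
theorem integral_evalChar_mul_iterate_eq_zero {n : ℕ} {k : DualGroup Γ} {γ : Γ}
    (hk : (dualEndo α)^[n] k = 1) (hγ : k (Multiplicative.ofAdd γ) ≠ 1) (g : DualGroup Γ → ℂ) :
    ∫ ω, evalChar γ ω * g ((dualEndo α)^[n] ω) ∂(dualHaar Γ) = 0 := by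
  have h := integral_mul_left_eq_self (μ := dualHaar Γ)
    (fun ω => evalChar γ ω * g ((dualEndo α)^[n] ω)) k
  simp only [evalChar_mul_apply, iterate_dualEndo_mul, hk, one_mul, mul_assoc] at h
  rw [integral_const_mul] at h
  have hne : evalChar γ k ≠ 1 := fun h' => hγ (Subtype.ext h')
  by_contra h0
  exact hne (mul_right_cancel₀ h0 (h.trans (one_mul _).symm))

/-- The dual endomorphism is exact on trigonometric polynomials. -/
theorem eventually_integral_mul_iterate_eq (hα : Function.Injective α)
    (hindex : α.range.FiniteIndex) (hinter : ⋂ n : ℕ, Set.range (α^[n]) = {0})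
    {p : C(DualGroup Γ, ℂ)} (hp : p ∈ Submodule.span ℂ (Set.range (evalChar (Γ := Γ)))) :
    ∃ n₀ : ℕ, ∀ n ≥ n₀, ∀ g : DualGroup Γ → ℂ, Measurable g → (∀ ω, ‖g ω‖ ≤ 1) →
      ∫ ω, p ω * g ((dualEndo α)^[n] ω) ∂(dualHaar Γ) =
        (∫ ω, p ω ∂(dualHaar Γ)) * ∫ ω, g ω ∂(dualHaar Γ) := by
  have hint : ∀ (q : C(DualGroup Γ, ℂ)) (n : ℕ) (g : DualGroup Γ → ℂ), Measurable g →
      (∀ ω, ‖g ω‖ ≤ 1) →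
      Integrable (fun ω => q ω * g ((dualEndo α)^[n] ω)) (dualHaar Γ) := by
    intro q n g hg hg1
    have hq : Integrable (fun ω => q ω) (dualHaar Γ) :=
      q.continuous.integrable_of_hasCompactSupport (HasCompactSupport.of_compactSpace _)
    refine hq.mul_bdd (c := 1) ?_ (.of_forall fun ω => hg1 _)
    exact (hg.comp ((map_continuous (dualEndo α)).measurable.iterate n)).aestronglyMeasurable
  have hintc : ∀ q : C(DualGroup Γ, ℂ), Integrable (fun ω => q ω) (dualHaar Γ) := fun q =>
    q.continuous.integrable_of_hasCompactSupport (HasCompactSupport.of_compactSpace _)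
  induction hp using Submodule.span_induction with
  | mem x hx =>
    obtain ⟨γ, rfl⟩ := hx
    -- For the trivial character the identity is invariance of Haar measure; for any other, both
    -- sides eventually vanish.
    by_cases hγ : γ = 0
    · subst hγ
      refine ⟨0, fun n _ g hg _ => ?_⟩
      have h1 : ∀ ω : DualGroup Γ, evalChar 0 ω = 1 := fun ω => by simp [evalChar_apply]
      simp only [h1, one_mul, integral_const, probReal_univ, one_smul]
      have hmp := (measurePreserving_dualEndo hα).iterate n
      rw [← integral_map hmp.measurable.aemeasurable hg.aestronglyMeasurable, hmp.map_eq]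
    · obtain ⟨n₀, h⟩ := exists_iterate_eq_one_apply_ne_one hα hindex hinter hγ
      refine ⟨n₀, fun n hn g hg _ => ?_⟩
      obtain ⟨k, hk, hne⟩ := h n hn
      rw [integral_evalChar_mul_iterate_eq_zero hk hne]
      have := integral_evalChar_mul_iterate_eq_zero hk hne (fun _ => 1)
      simp only [mul_one] at this
      rw [this, zero_mul]
  | zero => exact ⟨0, fun n _ g _ _ => by simp⟩
  | add x y _ _ hx hy =>
    obtain ⟨n₁, h₁⟩ := hx
    obtain ⟨n₂, h₂⟩ := hy
    refine ⟨max n₁ n₂, fun n hn g hg hg1 => ?_⟩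
    simp only [ContinuousMap.add_apply, add_mul]
    rw [integral_add (hint x n g hg hg1) (hint y n g hg hg1), integral_add (hintc x) (hintc y),
      h₁ n (le_trans (le_max_left _ _) hn) g hg hg1,
      h₂ n (le_trans (le_max_right _ _) hn) g hg hg1, add_mul]
  | smul a x _ hx =>
    obtain ⟨n₁, h₁⟩ := hx
    refine ⟨n₁, fun n hn g hg hg1 => ?_⟩
    simp only [ContinuousMap.smul_apply, smul_eq_mul, mul_assoc]
    rw [integral_const_mul, integral_const_mul, h₁ n hn g hg hg1, mul_assoc]

theorem exists_trigPolynomial_integral_sub_le {h : DualGroup Γ → ℂ}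
    (hh : Integrable h (dualHaar Γ)) {ε : ℝ} (hε : 0 < ε) :
    ∃ p ∈ Submodule.span ℂ (Set.range (evalChar (Γ := Γ))),
      ∫ ω, ‖h ω - p ω‖ ∂(dualHaar Γ) ≤ ε := by
  obtain ⟨q, -, hq, hqc, hqi⟩ := hh.exists_hasCompactSupport_integral_sub_le (half_pos hε)
  have hmem : (⟨q, hqc⟩ : C(DualGroup Γ, ℂ)) ∈
      (Submodule.span ℂ (Set.range (evalChar (Γ := Γ)))).topologicalClosure := by
    rw [dense_span_evalChar]; trivial
  obtain ⟨p, hp, hd⟩ := Metric.mem_closure_iff.1 hmem (ε / 2) (half_pos hε)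
  refine ⟨p, hp, ?_⟩
  have hpi : Integrable (fun ω => p ω) (dualHaar Γ) :=
    p.continuous.integrable_of_hasCompactSupport (HasCompactSupport.of_compactSpace _)
  have hle : ∀ ω, ‖h ω - p ω‖ ≤ ‖h ω - q ω‖ + ε / 2 := fun ω => by
    have h1 : ‖q ω - p ω‖ ≤ ε / 2 := by
      rw [← dist_eq_norm]
      exact (ContinuousMap.dist_apply_le_dist (f := ⟨q, hqc⟩) (g := p) ω).trans hd.le
    calc ‖h ω - p ω‖ = ‖(h ω - q ω) + (q ω - p ω)‖ := by ring_nf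
      _ ≤ _ := (norm_add_le _ _).trans (by linarith)
  calc ∫ ω, ‖h ω - p ω‖ ∂(dualHaar Γ) ≤ ∫ ω, (‖h ω - q ω‖ + ε / 2) ∂(dualHaar Γ) :=
        integral_mono (hh.sub hpi).norm ((hh.sub hqi).norm.add (integrable_const _)) hle
    _ = (∫ ω, ‖h ω - q ω‖ ∂(dualHaar Γ)) + ε / 2 := by
        have := integral_add (hh.sub hqi).norm (integrable_const (μ := dualHaar Γ) (ε / 2))
        simpa using this
    _ ≤ ε := by linarith

/-- Uniform mixing: the dual endomorphism is exact. -/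
theorem exists_norm_integral_mul_iterate_sub_le (hα : Function.Injective α)
    (hindex : α.range.FiniteIndex) (hinter : ⋂ n : ℕ, Set.range (α^[n]) = {0})
    {h : DualGroup Γ → ℂ} (hh : Integrable h (dualHaar Γ)) {ε : ℝ} (hε : 0 < ε) :
    ∃ n₀ : ℕ, ∀ n ≥ n₀, ∀ g : DualGroup Γ → ℂ, Measurable g → (∀ ω, ‖g ω‖ ≤ 1) →
      ‖(∫ ω, h ω * g ((dualEndo α)^[n] ω) ∂(dualHaar Γ)) -
        (∫ ω, h ω ∂(dualHaar Γ)) * ∫ ω, g ω ∂(dualHaar Γ)‖ ≤ ε := by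
  obtain ⟨p, hp, hhp⟩ := exists_trigPolynomial_integral_sub_le hh (half_pos hε)
  obtain ⟨n₀, hn₀⟩ := eventually_integral_mul_iterate_eq hα hindex hinter hp
  refine ⟨n₀, fun n hn g hg hg1 => ?_⟩
  have hpi : Integrable (fun ω => p ω) (dualHaar Γ) :=
    p.continuous.integrable_of_hasCompactSupport (HasCompactSupport.of_compactSpace _)
  have hgm : AEStronglyMeasurable (fun ω => g ((dualEndo α)^[n] ω)) (dualHaar Γ) :=
    (hg.comp ((map_continuous (dualEndo α)).measurable.iterate n)).aestronglyMeasurable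
  have hgb : ∀ᵐ ω ∂(dualHaar Γ), ‖g ((dualEndo α)^[n] ω)‖ ≤ 1 := .of_forall fun ω => hg1 _
  -- The polynomial `p` contributes nothing to the defect from `n₀` on, so only the L¹-small
  -- remainder `h - p` is left.
  have e1 : (∫ ω, h ω * g ((dualEndo α)^[n] ω) ∂(dualHaar Γ)) -
      (∫ ω, h ω ∂(dualHaar Γ)) * ∫ ω, g ω ∂(dualHaar Γ) =
      (∫ ω, (h ω - p ω) * g ((dualEndo α)^[n] ω) ∂(dualHaar Γ)) -
        (∫ ω, (h ω - p ω) ∂(dualHaar Γ)) * ∫ ω, g ω ∂(dualHaar Γ) := by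
    simp only [sub_mul]
    rw [integral_sub (hh.mul_bdd hgm hgb) (hpi.mul_bdd hgm hgb), integral_sub hh hpi,
      hn₀ n hn g hg hg1]
    ring
  have e2 : ‖∫ ω, (h ω - p ω) * g ((dualEndo α)^[n] ω) ∂(dualHaar Γ)‖ ≤ ε / 2 := by
    refine (norm_integral_le_integral_norm _).trans (le_trans ?_ hhp)
    refine integral_mono ((hh.sub hpi).mul_bdd hgm hgb).norm (hh.sub hpi).norm fun ω => ?_
    simp only [norm_mul]
    exact mul_le_of_le_one_right (norm_nonneg _) (hg1 _)
  have e3 : ‖∫ ω, (h ω - p ω) ∂(dualHaar Γ)‖ ≤ ε / 2 :=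
    (norm_integral_le_integral_norm _).trans hhp
  have e4 : ‖∫ ω, g ω ∂(dualHaar Γ)‖ ≤ 1 := by
    simpa using norm_integral_le_of_norm_le_const (μ := dualHaar Γ) (.of_forall hg1)
  rw [e1]
  refine (norm_sub_le _ _).trans ?_
  rw [norm_mul]
  have := mul_le_mul e3 e4 (norm_nonneg _) (half_pos hε).le
  linarith

end Mixing

/-! ### The filter equation in integrated form -/

noncomputable section Filter

open scoped ENNReal NNReal

variable {Γ : Type*} [AddCommGroup Γ] [TopologicalSpace Γ] [DiscreteTopology Γ]
  {α : Γ →+ Γ} {B : Set (DualGroup Γ)} {m : DualGroup Γ → ℂ}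

theorem sum_ker_eq_finsum_fiber [Fintype (dualEndo α : DualGroup Γ →* DualGroup Γ).ker]
    (h : DualGroup Γ → ℝ) (ω : DualGroup Γ) :
    ∑ k : (dualEndo α : DualGroup Γ →* DualGroup Γ).ker, h (k * ω) =
      ∑ᶠ (ζ : DualGroup Γ) (_ : dualEndo α ζ = dualEndo α ω), h ζ := by
  have himg : {ζ : DualGroup Γ | dualEndo α ζ = dualEndo α ω} =
      (fun k => k * ω) '' ((dualEndo α : DualGroup Γ →* DualGroup Γ).ker : Set (DualGroup Γ)) := by
    ext ζ
    constructor
    · intro hζ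
      refine ⟨ζ * ω⁻¹, ?_, by simp⟩
      change dualEndo α (ζ * ω⁻¹) = 1
      rw [map_mul, map_inv, show dualEndo α ζ = dualEndo α ω from hζ, mul_inv_cancel]
    · rintro ⟨k, hk, rfl⟩
      change dualEndo α (k * ω) = dualEndo α ω
      rw [map_mul, show dualEndo α k = 1 from hk, one_mul]
  change _ = ∑ᶠ ζ ∈ {ζ : DualGroup Γ | dualEndo α ζ = dualEndo α ω}, h ζ
  rw [himg, finsum_mem_image (mul_left_injective ω).injOn, ← finsum_set_coe_eq_finsum_mem,
    ← finsum_eq_sum_of_fintype]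
  rfl

/-- The quadrature mirror filter equation, in integrated form. -/
def IsIntegratedFilter (α : Γ →+ Γ) (B : Set (DualGroup Γ)) (m : DualGroup Γ → ℂ) : Prop :=
  ∀ ⦃G : DualGroup Γ → ℝ≥0∞⦄, Measurable G →
    ∫⁻ ω, ‖m ω‖ₑ ^ 2 * G (dualEndo α ω) ∂(dualHaar Γ) = ∫⁻ ω in B, G ω ∂(dualHaar Γ)

/-- Fibres of `α*` are cosets of its kernel, which has `N` elements. Translating by each of them and
summing produces the fibre sum of `|m|²`; the factor `N` then cancels. -/
theorem isIntegratedFilter_of_finsum_eq (hα : Function.Injective α)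
    (hindex : α.range.FiniteIndex) (hB : MeasurableSet B) (hm : Measurable m)
    (hfilter : ∀ᵐ ω ∂(dualHaar Γ),
      ∑ᶠ (ζ : DualGroup Γ) (_ : dualEndo α ζ = ω), ‖m ζ‖ ^ 2
        = (α.range.index : ℝ) * B.indicator (fun _ => (1 : ℝ)) ω) :
    IsIntegratedFilter α B m := by
  intro G hG
  have hfin := finite_ker_dualEndo hindex
  have := Fintype.ofFinite (dualEndo α : DualGroup Γ →* DualGroup Γ).ker
  have hσ : Measurable (dualEndo α) := (map_continuous (dualEndo α)).measurable
  have hpt : ∀ᵐ ω ∂(dualHaar Γ),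
      ∑ k : (dualEndo α : DualGroup Γ →* DualGroup Γ).ker, ‖m (k * ω)‖ₑ ^ 2 =
        (α.range.index : ℝ≥0∞) * B.indicator (fun _ => (1 : ℝ≥0∞)) (dualEndo α ω) := by
    filter_upwards [(measurePreserving_dualEndo hα).quasiMeasurePreserving.ae hfilter] with ω hω
    rw [← sum_ker_eq_finsum_fiber] at hω
    have h1 : ∀ z : ℂ, ‖z‖ₑ ^ 2 = ENNReal.ofReal (‖z‖ ^ 2) := fun z => by
      rw [ENNReal.ofReal_pow (norm_nonneg _), ofReal_norm]
    simp only [h1]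
    rw [← ENNReal.ofReal_sum_of_nonneg (fun _ _ => by positivity), hω,
      ENNReal.ofReal_mul (by positivity), ENNReal.ofReal_natCast]
    by_cases hb : dualEndo α ω ∈ B <;> simp [hb]
  have hk : ∀ k : (dualEndo α : DualGroup Γ →* DualGroup Γ).ker,
      ∫⁻ ω, ‖m (k * ω)‖ₑ ^ 2 * G (dualEndo α ω) ∂(dualHaar Γ) =
        ∫⁻ ω, ‖m ω‖ₑ ^ 2 * G (dualEndo α ω) ∂(dualHaar Γ) := fun k => by
    rw [← lintegral_mul_left_eq_self (μ := dualHaar Γ)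
      (fun ω => ‖m ω‖ₑ ^ 2 * G (dualEndo α ω)) (k : DualGroup Γ)]
    have hk1 : dualEndo α (k : DualGroup Γ) = 1 := k.2
    simp only [map_mul, hk1, one_mul]
  have hN0 : (α.range.index : ℝ≥0∞) ≠ 0 := by exact_mod_cast hindex.index_ne_zero
  have hkm : ∀ k : DualGroup Γ, Measurable fun ω => ‖m (k * ω)‖ₑ ^ 2 * G (dualEndo α ω) :=
    fun k => (((hm.comp (measurable_const_mul k)).enorm).pow_const 2).mul (hG.comp hσ)
  refine (ENNReal.mul_right_inj hN0 (ENNReal.natCast_ne_top _)).1 ?_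
  calc (α.range.index : ℝ≥0∞) * ∫⁻ ω, ‖m ω‖ₑ ^ 2 * G (dualEndo α ω) ∂(dualHaar Γ)
      = ∑ k : (dualEndo α : DualGroup Γ →* DualGroup Γ).ker,
          ∫⁻ ω, ‖m (k * ω)‖ₑ ^ 2 * G (dualEndo α ω) ∂(dualHaar Γ) := by
        simp only [hk, Finset.sum_const, nsmul_eq_mul]
        rw [← card_ker_dualEndo hindex, Nat.card_eq_fintype_card, Finset.card_univ]
    _ = ∫⁻ ω, (∑ k : (dualEndo α : DualGroup Γ →* DualGroup Γ).ker, ‖m (k * ω)‖ₑ ^ 2) *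
          G (dualEndo α ω) ∂(dualHaar Γ) := by
        simp only [Finset.sum_mul]
        rw [lintegral_finsetSum Finset.univ fun (k : (dualEndo α : DualGroup Γ →* DualGroup Γ).ker) _ =>
          hkm k]
    _ = ∫⁻ ω, (α.range.index : ℝ≥0∞) * (B.indicator G) (dualEndo α ω) ∂(dualHaar Γ) := by
        refine lintegral_congr_ae ?_
        filter_upwards [hpt] with ω hω
        rw [hω, mul_assoc]
        by_cases hb : dualEndo α ω ∈ B <;> simp [hb]
    _ = (α.range.index : ℝ≥0∞) * ∫⁻ ω in B, G ω ∂(dualHaar Γ) := by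
        rw [lintegral_const_mul' _ _ (ENNReal.natCast_ne_top _),
          (measurePreserving_dualEndo hα).lintegral_comp (hG.indicator hB), lintegral_indicator hB]

/-! ### Backward orbits and the limit of their densities -/

section Backward

/-- `F` is an orbit under the inverse of the weighted composition operator `f ↦ m • f ∘ α*` on
functions supported on `B`. -/
structure IsBackwardOrbit (α : Γ →+ Γ) (B : Set (DualGroup Γ)) (m : DualGroup Γ → ℂ)
    (F : ℕ → DualGroup Γ → ℂ) : Prop where
  measurable : ∀ n, Measurable (F n)
  memLp : MemLp (F 0) 2 (dualHaar Γ)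
  eq_zero : ∀ n, ∀ ω ∉ B, F n ω = 0
  ae_eq : ∀ n, F n =ᵐ[dualHaar Γ] fun ω => m ω * F (n + 1) (dualEndo α ω)

variable {F : ℕ → DualGroup Γ → ℂ}

theorem IsBackwardOrbit.lintegral_mul_iterate (hF : IsBackwardOrbit α B m F)
    (hkey : IsIntegratedFilter α B m)
    (hB : MeasurableSet B) (n : ℕ) {G : DualGroup Γ → ℝ≥0∞} (hG : Measurable G) :
    ∫⁻ ω, ‖F 0 ω‖ₑ ^ 2 * G ((dualEndo α)^[n] ω) ∂(dualHaar Γ) =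
      ∫⁻ ω, ‖F n ω‖ₑ ^ 2 * G ω ∂(dualHaar Γ) := by
  have hσ : Measurable (dualEndo α) := (map_continuous (dualEndo α)).measurable
  have hmeas : ∀ n, Measurable fun ω => ‖F n ω‖ₑ ^ 2 := fun n =>
    (hF.measurable n).enorm.pow_const 2
  induction n generalizing G with
  | zero => rfl
  | succ n ih =>
    simp only [Function.iterate_succ_apply']
    refine (ih (hG.comp hσ)).trans ?_
    calc ∫⁻ ω, ‖F n ω‖ₑ ^ 2 * (G ∘ dualEndo α) ω ∂(dualHaar Γ)
        = ∫⁻ ω, ‖m ω‖ₑ ^ 2 * (fun η => ‖F (n + 1) η‖ₑ ^ 2 * G η) (dualEndo α ω)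
            ∂(dualHaar Γ) := by
          refine lintegral_congr_ae ?_
          filter_upwards [hF.ae_eq n] with ω hω
          simp only [hω, enorm_mul, mul_pow, mul_assoc, Function.comp_apply]
      _ = ∫⁻ ω in B, ‖F (n + 1) ω‖ₑ ^ 2 * G ω ∂(dualHaar Γ) := hkey ((hmeas _).mul hG)
      _ = ∫⁻ ω, ‖F (n + 1) ω‖ₑ ^ 2 * G ω ∂(dualHaar Γ) := by
          rw [← lintegral_indicator hB]
          congr 1
          ext ω
          by_cases hb : ω ∈ B <;> simp [hb, hF.eq_zero (n + 1) ω]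

/-- The nonnegative version, tested on indicators, is an equality of measures, which then integrates
complex `g`. -/
theorem IsBackwardOrbit.integral_mul_iterate (hF : IsBackwardOrbit α B m F)
    (hkey : IsIntegratedFilter α B m)
    (hB : MeasurableSet B) (n : ℕ) {g : DualGroup Γ → ℂ} (hg : Measurable g) :
    ∫ ω, ((‖F 0 ω‖ ^ 2 : ℝ) : ℂ) * g ((dualEndo α)^[n] ω) ∂(dualHaar Γ) =
      ∫ ω, ((‖F n ω‖ ^ 2 : ℝ) : ℂ) * g ω ∂(dualHaar Γ) := by
  have hσn : Measurable (dualEndo α)^[n] := (map_continuous (dualEndo α)).measurable.iterate n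
  have hmeas : ∀ n, Measurable fun ω => ‖F n ω‖₊ ^ 2 := fun n =>
    (hF.measurable n).nnnorm.pow_const 2
  have hcoe : ∀ n ω, ((‖F n ω‖₊ ^ 2 : ℝ≥0) : ℝ≥0∞) = ‖F n ω‖ₑ ^ 2 := fun n ω => by
    rw [ENNReal.coe_pow]; rfl
  have hmap : ((dualHaar Γ).withDensity fun ω => ((‖F 0 ω‖₊ ^ 2 : ℝ≥0) : ℝ≥0∞)).map
      (dualEndo α)^[n] = (dualHaar Γ).withDensity fun ω => ((‖F n ω‖₊ ^ 2 : ℝ≥0) : ℝ≥0∞) := by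
    refine Measure.ext fun A hA => ?_
    rw [Measure.map_apply hσn hA, withDensity_apply _ (hσn hA), withDensity_apply _ hA,
      ← lintegral_indicator (hσn hA), ← lintegral_indicator hA]
    have h := hF.lintegral_mul_iterate hkey hB n
      ((measurable_const (a := (1 : ℝ≥0∞))).indicator hA)
    convert h using 2 <;> ext ω
    · by_cases hb : (dualEndo α)^[n] ω ∈ A <;> simp [hb, hcoe]
    · by_cases hb : ω ∈ A <;> simp [hb, hcoe]
  have hint : ∀ (n : ℕ) (u : DualGroup Γ → ℂ),
      ∫ ω, u ω ∂((dualHaar Γ).withDensity fun ω => ((‖F n ω‖₊ ^ 2 : ℝ≥0) : ℝ≥0∞)) =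
        ∫ ω, ((‖F n ω‖ ^ 2 : ℝ) : ℂ) * u ω ∂(dualHaar Γ) := fun n u => by
    rw [integral_withDensity_eq_integral_smul (hmeas n)]
    refine integral_congr_ae (.of_forall fun ω => ?_)
    simp [NNReal.smul_def, Complex.real_smul]
  rw [← hint n, ← hmap, integral_map hσn.aemeasurable hg.aestronglyMeasurable, hint 0]

theorem IsBackwardOrbit.integrable (hF : IsBackwardOrbit α B m F)
    (hkey : IsIntegratedFilter α B m)
    (hB : MeasurableSet B) (n : ℕ) : Integrable (fun ω => ‖F n ω‖ ^ 2) (dualHaar Γ) := by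
  have h0 : Integrable (fun ω => ‖F 0 ω‖ ^ 2) (dualHaar Γ) := hF.memLp.integrable_norm_pow two_ne_zero
  refine ⟨((hF.measurable n).norm.pow_const 2).aestronglyMeasurable, ?_⟩
  have h := hF.lintegral_mul_iterate hkey hB n (measurable_const (a := (1 : ℝ≥0∞)))
  have h1 := h0.2
  simp only [HasFiniteIntegral, enorm_pow, enorm_norm, mul_one] at h h1 ⊢
  rwa [← h]

/-- The densities `‖F n‖²` of a backward orbit converge in `L¹` to a constant. -/
theorem IsBackwardOrbit.exists_lintegral_enorm_sub_le (hF : IsBackwardOrbit α B m F)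
    (hα : Function.Injective α) (hindex : α.range.FiniteIndex)
    (hinter : ⋂ n : ℕ, Set.range (α^[n]) = {0})
    (hkey : IsIntegratedFilter α B m)
    (hB : MeasurableSet B) {ε : ℝ} (hε : 0 < ε) :
    ∃ n₀ : ℕ, ∀ n ≥ n₀, ∫⁻ ω, ‖‖F n ω‖ ^ 2 - ∫ η, ‖F 0 η‖ ^ 2 ∂(dualHaar Γ)‖ₑ ∂(dualHaar Γ) ≤
      ENNReal.ofReal ε := by
  obtain ⟨n₀, hn₀⟩ := exists_norm_integral_mul_iterate_sub_le hα hindex hinter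
    ((hF.integrable hkey hB 0).ofReal (𝕜 := ℂ)) hε
  refine ⟨n₀, fun n hn => ?_⟩
  set c := ∫ η, ‖F 0 η‖ ^ 2 ∂(dualHaar Γ) with hc
  have hFn := hF.integrable hkey hB n
  -- The sign of `|F n|² - c` turns the mixing defect into the L¹ norm. It depends on `n`, so `n₀`
  -- must be uniform in `g`.
  let g : DualGroup Γ → ℂ := fun ω => if c ≤ ‖F n ω‖ ^ 2 then 1 else -1
  have hg : Measurable g := Measurable.ite
    (measurableSet_le measurable_const ((hF.measurable n).norm.pow_const 2))
    measurable_const measurable_const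
  have hg1 : ∀ ω, ‖g ω‖ ≤ 1 := fun ω => by
    simp only [g]; split_ifs <;> simp
  have h := hn₀ n hn g hg hg1
  have e1 : ((∫ ω, |‖F n ω‖ ^ 2 - c| ∂(dualHaar Γ) : ℝ) : ℂ) =
      (∫ ω, ((‖F 0 ω‖ ^ 2 : ℝ) : ℂ) * g ((dualEndo α)^[n] ω) ∂(dualHaar Γ)) -
        (∫ ω, ((‖F 0 ω‖ ^ 2 : ℝ) : ℂ) ∂(dualHaar Γ)) * ∫ ω, g ω ∂(dualHaar Γ) := by
    have hgi : Integrable g (dualHaar Γ) :=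
      (integrable_const (1 : ℝ)).mono' hg.aestronglyMeasurable (.of_forall hg1)
    have hi1 : Integrable (fun ω => ((‖F n ω‖ ^ 2 : ℝ) : ℂ) * g ω) (dualHaar Γ) :=
      (hFn.ofReal (𝕜 := ℂ)).mul_bdd (c := 1) hg.aestronglyMeasurable (.of_forall hg1)
    rw [hF.integral_mul_iterate hkey hB n hg, integral_complex_ofReal, ← hc,
      ← integral_const_mul, ← integral_sub hi1 (hgi.const_mul _), ← integral_complex_ofReal]
    refine integral_congr_ae (.of_forall fun ω => ?_)
    simp only [g]
    split_ifs with hle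
    · rw [abs_of_nonneg (sub_nonneg.2 hle)]; push_cast; ring
    · rw [abs_of_neg (sub_neg.2 (not_le.1 hle))]; push_cast; ring
  have e2 : ∫ ω, |‖F n ω‖ ^ 2 - c| ∂(dualHaar Γ) ≤ ε := by
    refine (le_abs_self _).trans ?_
    rw [← Real.norm_eq_abs, ← Complex.norm_real, e1]
    exact h
  have e3 := ofReal_integral_norm_eq_lintegral_enorm (hFn.sub (integrable_const c))
  simp only [Pi.sub_apply, Real.norm_eq_abs] at e3
  rw [← e3]
  exact ENNReal.ofReal_le_ofReal e2

/-- The L¹ norm of `c (|m|² - 1)` does not depend on `n`, yet is bounded by the distances of `|F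
n|²` and `|F (n+1)|²` from `c`. -/
theorem IsBackwardOrbit.ae_eq_zero (hF : IsBackwardOrbit α B m F)
    (hα : Function.Injective α) (hindex : α.range.FiniteIndex)
    (hinter : ⋂ n : ℕ, Set.range (α^[n]) = {0}) (hm : Measurable m)
    (hkey : IsIntegratedFilter α B m)
    (hB : MeasurableSet B) (hne : 0 < dualHaar Γ {ω | ‖m ω‖ ≠ 1}) :
    F 0 =ᵐ[dualHaar Γ] 0 := by
  set c := ∫ η, ‖F 0 η‖ ^ 2 ∂(dualHaar Γ) with hc
  have hσ : Measurable (dualEndo α) := (map_continuous (dualEndo α)).measurable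
  have hD : ∀ n, Measurable fun ω => ‖‖F n ω‖ ^ 2 - c‖ₑ := fun n =>
    (((hF.measurable n).norm.pow_const 2).sub_const c).enorm
  have hbound : ∀ n, ∫⁻ ω, ‖c * (‖m ω‖ ^ 2 - 1)‖ₑ ∂(dualHaar Γ) ≤
      ∫⁻ ω, ‖‖F n ω‖ ^ 2 - c‖ₑ ∂(dualHaar Γ) +
        ∫⁻ ω, ‖‖F (n + 1) ω‖ ^ 2 - c‖ₑ ∂(dualHaar Γ) := fun n => by
    calc ∫⁻ ω, ‖c * (‖m ω‖ ^ 2 - 1)‖ₑ ∂(dualHaar Γ)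
        ≤ ∫⁻ ω, (‖‖F n ω‖ ^ 2 - c‖ₑ +
            ‖m ω‖ₑ ^ 2 * (fun η => ‖‖F (n + 1) η‖ ^ 2 - c‖ₑ) (dualEndo α ω)) ∂(dualHaar Γ) := by
          refine lintegral_mono_ae ?_
          filter_upwards [hF.ae_eq n] with ω hω
          have e : c * (‖m ω‖ ^ 2 - 1) = (‖F n ω‖ ^ 2 - c) -
              ‖m ω‖ ^ 2 * (‖F (n + 1) (dualEndo α ω)‖ ^ 2 - c) := by
            rw [hω, norm_mul]; ring
          rw [e]
          refine enorm_sub_le.trans (le_of_eq ?_)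
          rw [enorm_mul, enorm_pow, enorm_norm]
      _ = ∫⁻ ω, ‖‖F n ω‖ ^ 2 - c‖ₑ ∂(dualHaar Γ) +
            ∫⁻ ω in B, ‖‖F (n + 1) ω‖ ^ 2 - c‖ₑ ∂(dualHaar Γ) := by
          -- The integrated filter equation absorbs the possibly unbounded weight `|m|²`.
          rw [lintegral_add_left (hD n), hkey (hD (n + 1))]
      _ ≤ _ := by
          gcongr
          exact Measure.restrict_le_self
  have hzero : ∫⁻ ω, ‖c * (‖m ω‖ ^ 2 - 1)‖ₑ ∂(dualHaar Γ) = 0 := by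
    refine nonpos_iff_eq_zero.1 (ENNReal.le_of_forall_pos_le_add fun ε hε _ => ?_)
    obtain ⟨n, hn⟩ := hF.exists_lintegral_enorm_sub_le hα hindex hinter hkey hB
      (half_pos (NNReal.coe_pos.2 hε))
    refine (hbound n).trans ((add_le_add (hn n le_rfl) (hn (n + 1) n.le_succ)).trans ?_)
    rw [← ENNReal.ofReal_add (by positivity) (by positivity), add_halves, zero_add,
      ENNReal.ofReal_coe_nnreal]
  have hc0 : c = 0 := by
    by_contra hc0
    rw [lintegral_eq_zero_iff ((((hm.norm.pow_const 2).sub_const 1).const_mul c).enorm)] at hzero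
    refine hne.ne' (measure_mono_null ?_ (ae_iff.1 hzero))
    intro ω hω h0
    have h1 : ‖m ω‖ ^ 2 - 1 = 0 := by simpa [hc0] using h0
    exact hω ((sq_eq_sq₀ (norm_nonneg _) zero_le_one).1 (by linarith))
  have h0 := (integral_eq_zero_iff_of_nonneg (fun ω => by positivity)
    (hF.integrable hkey hB 0)).1 hc0
  filter_upwards [h0] with ω hω
  simpa using hω

end Backward

end Filter

/-! ### The isometry and its purity -/

noncomputable section WeightedComposition

open scoped ENNReal NNReal

variable {Γ : Type*} [AddCommGroup Γ] [TopologicalSpace Γ] [DiscreteTopology Γ]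
  {α : Γ →+ Γ} {B : Set (DualGroup Γ)} {m : DualGroup Γ → ℂ}

variable (α m) in
/-- The weighted composition `ω ↦ m ω * f (α* ω)`, where `f` is extended by zero off `B`. -/
def weightedComp (f : L2On B) : DualGroup Γ → ℂ :=
  fun ω => m ω * B.indicator f (dualEndo α ω)

theorem L2On.measurable_indicator (hB : MeasurableSet B) (f : L2On B) :
    Measurable (B.indicator f) :=
  (Lp.stronglyMeasurable f).measurable.indicator hB

theorem measurable_weightedComp (hB : MeasurableSet B) (hm : Measurable m) (f : L2On B) :
    Measurable (weightedComp α m f) :=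
  hm.mul ((L2On.measurable_indicator hB f).comp (map_continuous (dualEndo α)).measurable)

theorem eLpNorm_weightedComp (hB : MeasurableSet B)
    (hkey : IsIntegratedFilter α B m) (hsupp : ∀ᵐ ω ∂(dualHaar Γ), ω ∉ B → m ω = 0)
    (f : L2On B) :
    eLpNorm (weightedComp α m f) 2 ((dualHaar Γ).restrict B) =
      eLpNorm f 2 ((dualHaar Γ).restrict B) := by
  have hsq : ∀ u : DualGroup Γ → ℂ, eLpNorm u 2 ((dualHaar Γ).restrict B) =
      (∫⁻ ω in B, ‖u ω‖ₑ ^ 2 ∂(dualHaar Γ)) ^ (1 / 2 : ℝ) := fun u => by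
    rw [eLpNorm_eq_lintegral_rpow_enorm_toReal two_ne_zero ENNReal.ofNat_ne_top]
    simp
  rw [hsq, hsq]
  congr 1
  calc ∫⁻ ω in B, ‖weightedComp α m f ω‖ₑ ^ 2 ∂(dualHaar Γ)
      = ∫⁻ ω, ‖weightedComp α m f ω‖ₑ ^ 2 ∂(dualHaar Γ) := by
        rw [← lintegral_indicator hB]
        refine lintegral_congr_ae ?_
        filter_upwards [hsupp] with ω hω
        by_cases hb : ω ∈ B <;> simp [hb, weightedComp, hω]
    _ = ∫⁻ ω, ‖m ω‖ₑ ^ 2 * (fun η => ‖B.indicator f η‖ₑ ^ 2) (dualEndo α ω) ∂(dualHaar Γ) := by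
        simp only [weightedComp, enorm_mul, mul_pow]
    _ = ∫⁻ ω in B, ‖B.indicator f ω‖ₑ ^ 2 ∂(dualHaar Γ) :=
        hkey ((L2On.measurable_indicator hB f).enorm.pow_const 2)
    _ = ∫⁻ ω in B, ‖f ω‖ₑ ^ 2 ∂(dualHaar Γ) := by
        refine setLIntegral_congr_fun hB fun ω hω => ?_
        simp [hω]

/-- Preimages of null sets under `α*` are null, so the choice of representative is immaterial;
linearity of the operator rests on this. -/
theorem weightedComp_ae_eq (hα : Function.Injective α) (hB : MeasurableSet B) {f : L2On B}
    {u : DualGroup Γ → ℂ} (h : f =ᵐ[(dualHaar Γ).restrict B] u) :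
    weightedComp α m f =ᵐ[dualHaar Γ] fun ω => m ω * B.indicator u (dualEndo α ω) := by
  have h1 : B.indicator f =ᵐ[dualHaar Γ] B.indicator u := by
    filter_upwards [(ae_restrict_iff' hB).1 h] with ω hω
    by_cases hb : ω ∈ B <;> simp [hb, hω]
  filter_upwards [(measurePreserving_dualEndo hα).quasiMeasurePreserving.ae_eq_comp h1] with ω hω
  simp only [weightedComp]
  exact congrArg (m ω * ·) hω

/-- The weighted composition operator of a filter, as a linear isometry. -/
theorem exists_linearIsometry_weightedComp (hα : Function.Injective α) (hB : MeasurableSet B)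
    (hm : Measurable m) (hkey : IsIntegratedFilter α B m)
    (hsupp : ∀ᵐ ω ∂(dualHaar Γ), ω ∉ B → m ω = 0) :
    ∃ S : L2On B →ₗᵢ[ℂ] L2On B, ∀ f, B.indicator (S f) =ᵐ[dualHaar Γ] weightedComp α m f := by
  have hmem : ∀ f : L2On B, MemLp (weightedComp α m f) 2 ((dualHaar Γ).restrict B) := fun f =>
    ⟨(measurable_weightedComp hB hm f).aestronglyMeasurable, by
      rw [eLpNorm_weightedComp hB hkey hsupp]; exact (Lp.memLp f).2⟩
  let S : L2On B →ₗᵢ[ℂ] L2On B :=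
    { toFun := fun f => (hmem f).toLp _
      map_add' := fun f g => by
        rw [← MemLp.toLp_add]
        refine MemLp.toLp_congr _ _ (ae_restrict_of_ae ?_)
        filter_upwards [weightedComp_ae_eq (m := m) hα hB (Lp.coeFn_add f g)] with ω hω
        rw [hω, Set.indicator_add']
        simp only [weightedComp, Pi.add_apply, mul_add]
      map_smul' := fun a f => by
        rw [RingHom.id_apply, ← MemLp.toLp_const_smul]
        refine MemLp.toLp_congr _ _ (ae_restrict_of_ae ?_)
        filter_upwards [weightedComp_ae_eq (m := m) hα hB (Lp.coeFn_smul a f)] with ω hω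
        rw [hω]
        by_cases hb : dualEndo α ω ∈ B
        · simp [weightedComp, hb]; ring
        · simp [weightedComp, hb]
      norm_map' := fun f => by
        change ‖(hmem f).toLp _‖ = ‖f‖
        rw [Lp.norm_toLp, Lp.norm_def, eLpNorm_weightedComp hB hkey hsupp] }
  refine ⟨S, fun f => ?_⟩
  have h : S f =ᵐ[(dualHaar Γ).restrict B] weightedComp α m f := (hmem f).coeFn_toLp
  filter_upwards [(ae_restrict_iff' hB).1 h, hsupp] with ω h1 h2
  by_cases hb : ω ∈ B
  · simp [hb, h1 hb]
  · simp [hb, h2 hb, weightedComp]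

theorem woldUnitaryPart_eq_bot_of_weightedComp (hα : Function.Injective α)
    (hindex : α.range.FiniteIndex) (hinter : ⋂ n : ℕ, Set.range (α^[n]) = {0})
    (hB : MeasurableSet B) (hm : Measurable m) (hkey : IsIntegratedFilter α B m)
    (hne : 0 < dualHaar Γ {ω | ‖m ω‖ ≠ 1}) (S : L2On B →L[ℂ] L2On B) (hiso : ∀ f, ‖S f‖ = ‖f‖)
    (hS : ∀ f, B.indicator (S f) =ᵐ[dualHaar Γ] weightedComp α m f) :
    woldUnitaryPart S = ⊥ := by
  refine (Submodule.eq_bot_iff _).2 fun x hx => ?_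
  have hx' : ∀ n : ℕ, ∃ f : L2On B, (S ^ n) f = x := fun n => (Submodule.mem_iInf _).1 hx n
  choose f hf using hx'
  have hinj : ∀ n : ℕ, Function.Injective (S ^ n) := fun n => by
    have h1 : Function.Injective S := fun a b hab => by
      rw [← sub_eq_zero, ← norm_eq_zero, ← hiso, map_sub, hab, sub_self, norm_zero]
    rw [FunLike.coe_pow_eq_iterate]
    exact h1.iterate n
  have hf0 : f 0 = x := hf 0
  -- Separately chosen preimages are compatible: `S ^ n` is injective and sends both sides to `x`.
  have hfs : ∀ n, S (f (n + 1)) = f n := fun n => by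
    refine hinj n ?_
    rw [hf n, ← hf (n + 1), pow_succ]
    rfl
  have hF : IsBackwardOrbit α B m fun n => B.indicator (f n) :=
    { measurable := fun n => L2On.measurable_indicator hB _
      memLp := (memLp_indicator_iff_restrict hB).2 (Lp.memLp (f 0))
      eq_zero := fun n ω hω => Set.indicator_of_notMem hω _
      ae_eq := fun n => by
        have h := hS (f (n + 1))
        rwa [hfs n] at h }
  have h0 := hF.ae_eq_zero hα hindex hinter hm hkey hB hne
  rw [← hf0, Lp.eq_zero_iff_ae_eq_zero]
  refine (ae_restrict_iff' hB).2 ?_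
  filter_upwards [h0] with ω hω hb
  simpa [hb] using hω

theorem measure_norm_ne_one_pos (hsupp : ∀ᵐ ω ∂(dualHaar Γ), ω ∉ B → m ω = 0)
    (h : 0 < dualHaar Γ Bᶜ) : 0 < dualHaar Γ {ω | ‖m ω‖ ≠ 1} := by
  refine h.trans_le (measure_mono_ae ?_)
  filter_upwards [hsupp] with ω hω hb
  change ‖m ω‖ ≠ 1
  simp [hω hb]

end WeightedComposition

theorem theorem3p1 {Γ : Type*} [AddCommGroup Γ] [Countable Γ]
    [TopologicalSpace Γ] [DiscreteTopology Γ]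
    (α : Γ →+ Γ) (hα : Function.Injective α) (hindex : α.range.FiniteIndex)
    (hinter : ⋂ n : ℕ, Set.range (α^[n]) = {0})
    (B : Set (DualGroup Γ)) (hB : MeasurableSet B)
    (m : DualGroup Γ → ℂ) (hm : Measurable m)
    (hsupp : ∀ᵐ ω ∂(dualHaar Γ), ω ∉ B → m ω = 0)
    (hfilter : ∀ᵐ ω ∂(dualHaar Γ),
      ∑ᶠ (ζ : DualGroup Γ) (_ : dualEndo α ζ = ω), ‖m ζ‖ ^ 2
        = (α.range.index : ℝ) * B.indicator (fun _ => (1 : ℝ)) ω)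
    (hab : 0 < dualHaar Γ Bᶜ ∨ 0 < dualHaar Γ {ω | ‖m ω‖ ≠ 1}) :
    ∃ S : L2On B →L[ℂ] L2On B,
      -- functions on `B` are extended by zero to the whole dual group
      (∀ f : L2On B, B.indicator (S f) =ᵐ[dualHaar Γ]
        fun ω => m ω * B.indicator f (dualEndo α ω)) ∧
      IsPureIsometry S := by
  have hkey := isIntegratedFilter_of_finsum_eq hα hindex hB hm hfilter
  have hne := hab.elim (measure_norm_ne_one_pos hsupp) id
  obtain ⟨S, hS⟩ := exists_linearIsometry_weightedComp hα hB hm hkey hsupp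
  exact ⟨S.toContinuousLinearMap, hS, S.norm_map,
    woldUnitaryPart_eq_bot_of_weightedComp hα hindex hinter hB hm hkey hne _ S.norm_map hS⟩
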